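/- Let $\mathcal T\subseteq\mathbb R$ be a compact set, let $\delta>4$ be an integer, and let $\Psi:\mathcal T\times\mathcal T\to\mathbb R$ be symmetric and positive semi-definite, i.e. for every finite set $\mathbf t\subseteq\mathcal T$ the matrix $\Psi(\mathbf t,\mathbf t)=(\Psi(s,u))_{s,u\in\mathbf t}$ is symmetric and positive semi-definite. Then there is a unique probability measure $\lambda$ on $\mathbb R^{\mathcal T\times\mathcal T}$ with its product $\sigma$-algebra such that, for every finite set $\mathbf t\subseteq\mathcal T$, the image of $\lambda$ under the projection $\Sigma\mapsto\Sigma(\mathbf t,\mathbf t)=(\Sigma(s,u))_{s,u\in\mathbf t}$ is the Inverse-Wishart law $\mathrm{IW}(\delta,\Psi(\mathbf t,\mathbf t))$ in Dawid's parametrization. This measure is denoted $\mathrm{IWP}(\delta,\Psi)$. Here, for a positive definite $p\times p$ matrix $\Psi_0$, $\mathrm{IW}(\delta,\Psi_0)$ is the law of $K^{-1}$, where $K$ is Wishart distributed with $\delta+p-1$ degrees of freedom and scale matrix $\Psi_0^{-1}$, i.e. $K=\sum_{k=1}^{\delta+p-1}x_kx_k^{\top}$ with $x_1,\dots,x_{\delta+p-1}$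 independent $N(0,\Psi_0^{-1})$ vectors. For a singular positive semi-definite $p\times p$ matrix $\Psi_0$, $\mathrm{IW}(\delta,\Psi_0)$ is the degenerate law of $\Psi_0^{1/2}\,W\,\Psi_0^{1/2}$, where $W\sim\mathrm{IW}(\delta,I_p)$. -/

import Mathlib

open MeasureTheory ProbabilityTheory

noncomputable section

/-- The entrywise (product) σ-algebra on real matrices; for finite index types it is the Borel
σ-algebra of the finite-dimensional space of matrices. -/
instance matrixMeasurableSpace {m n : Type*} : MeasurableSpace (Matrix m n ℝ) :=
  inferInstanceAs (MeasurableSpace (m → n → ℝ))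

variable {ι : Type*} [Fintype ι] [DecidableEq ι]

/-- The Wishart distribution with `ν` degrees of freedom and scale matrix `S`: the law of
`∑ k, x k * (x k)ᵀ` for `ν` independent `N(0, S)` random vectors `x k`. -/
def wishart (ν : ℕ) (S : Matrix ι ι ℝ) : Measure (Matrix ι ι ℝ) :=
  (Measure.pi fun _ : Fin ν => multivariateGaussian (0 : EuclideanSpace ℝ ι) S).map
    fun x => ∑ k, Matrix.vecMulVec (x k).ofLp (x k).ofLp

/-- The Inverse-Wishart distribution in Dawid's parametrization for a positive definite `p × p`
scale matrix `Ψ`: the law of `K⁻¹`, where `K` is Wishart distributed with `δ + p - 1` degrees of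
freedom and scale matrix `Ψ⁻¹`. -/
def inverseWishartOfPosDef (δ : ℕ) (Ψ : Matrix ι ι ℝ) : Measure (Matrix ι ι ℝ) :=
  (wishart (δ + Fintype.card ι - 1) Ψ⁻¹).map fun K => K⁻¹

open scoped MatrixOrder in
open Classical in
/-- The Inverse-Wishart distribution `IW(δ, Ψ)` in Dawid's parametrization for a positive
semi-definite scale matrix `Ψ`. If `Ψ` is positive definite it is the law of the inverse of a
Wishart matrix, as above. If `Ψ` is singular it is the degenerate law of `Ψ^(1/2) * W * Ψ^(1/2)`
with `W ∼ IW(δ, 1)`, the standard extension by congruence. -/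
def inverseWishart (δ : ℕ) (Ψ : Matrix ι ι ℝ) : Measure (Matrix ι ι ℝ) :=
  if Ψ.PosDef then inverseWishartOfPosDef δ Ψ
  else (inverseWishartOfPosDef δ (1 : Matrix ι ι ℝ)).map
    fun W => CFC.sqrt Ψ * W * CFC.sqrt Ψ

/-- The matrix `F(t, t)` of the values of a function `F` of two variables on the grid `t × t`. -/
def gridMatrix {T : Type*} (t : Finset T) (F : T × T → ℝ) : Matrix t t ℝ :=
  Matrix.of fun i j => F (i, j)

/-- A symmetric and positive semi-definite mapping: its evaluation on every finite grid is a
symmetric positive semi-definite matrix (over `ℝ`, `Matrix.PosSemidef` includes symmetry). -/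
def IsPosSemidefKernel {T : Type*} (Ψ : T × T → ℝ) : Prop :=
  ∀ t : Finset T, (gridMatrix t Ψ).PosSemidef

open Classical in
/-- `μ` is an Inverse-Wishart process `IWP(δ, Ψ)`: a probability measure on `ℝ^(T × T)` with the
product σ-algebra, whose projection on every finite grid `t × t` is `IW(δ, Ψ(t, t))`. -/
def IsInverseWishartProcess {T : Type*} (δ : ℕ) (Ψ : T × T → ℝ)
    (μ : Measure (T × T → ℝ)) : Prop :=
  IsProbabilityMeasure μ ∧
    ∀ t : Finset T, μ.map (gridMatrix t) = inverseWishart δ (gridMatrix t Ψ)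

end

/-!
Let `Y` be a standard Gaussian matrix with `p` rows and `ν = δ + p - 1` columns, so that `(Y Yᵀ)⁻¹`
has law `IW(δ, 1)`. Delete the row and column of index `j` from `(Y Yᵀ)⁻¹`: by the Schur complement
formula what remains is `(Z Zᵀ)⁻¹`, where `Z` consists of the coordinates of the other rows of `Y`
in an orthonormal basis of the hyperplane orthogonal to row `j`. Conditionally on row `j`, the
matrix `Z` is again standard Gaussian, with `p - 1` rows and `ν - 1` columns. As `δ` counts columns
minus rows, the principal submatrices of `W ∼ IW(δ, 1)` have law `IW(δ, 1)`.

The law `IW(δ, 1)` is also invariant under `W ↦ O W Oᵀ` with `O` orthogonal, and two matrices with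
`A Aᵀ = B Bᵀ` differ by an orthogonal factor once they have equally many columns. Together with the
previous paragraph this shows that the law of `B W Bᵀ` depends only on `B Bᵀ`, even for rectangular
`B`; it is `IW(δ, B Bᵀ)`. In particular a congruence `M ↦ A M Aᵀ`, such as the passage to a
principal submatrix, maps `IW(δ, Ψ)` to `IW(δ, A Ψ Aᵀ)`, whether or not these matrices are singular.

Hence the laws on finite grids are consistent. Since every finite set of pairs lies in a grid,
they determine a projective family on `T × T`, and the Kolmogorov extension theorem applies.
-/

section KolmogorovExtension

open Filter Topology Set
open scoped ENNReal

theorem isCompactSystem_closedCompactCylinders {ι : Type*} (X : ι → Type*)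
    [∀ i, TopologicalSpace (X i)] : IsCompactSystem (closedCompactCylinders X) := by
  refine .of_nonempty_iInter fun C hC hne => ?_
  choose s K hKclosed hKcompact hCK using fun n => (mem_closedCompactCylinders _).1 (hC n)
  choose x hx using hne
  have hxK : ∀ k, ∀ᶠ n in hyperfilter ℕ, (s k).restrict (x n) ∈ K k := fun k => by
    filter_upwards [Nat.hyperfilter_le_atTop (eventually_ge_atTop k)] with n hn
    have hxk : x n ∈ C k := dissipate_subset hn (hx n)
    rwa [hCK] at hxk
  have hlim : ∀ i, ∃ z, (∃ k, i ∈ s k) → Tendsto (fun n => x n i) (hyperfilter ℕ) (𝓝 z) := by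
    intro i
    by_cases hi : ∃ k, i ∈ s k
    · obtain ⟨k, hk⟩ := hi
      obtain ⟨z, -, hz⟩ := ((hKcompact k).image (continuous_apply ⟨i, hk⟩)).ultrafilter_le_nhds
        ((hyperfilter ℕ).map fun n => x n i)
        (le_principal_iff.2 ((hxK k).mono fun n hn => mem_image_of_mem _ hn))
      exact ⟨z, fun _ => hz⟩
    · exact ⟨x 0 i, fun h => absurd h hi⟩
  choose z hz using hlim
  refine ⟨z, mem_iInter.2 fun k => ?_⟩
  rw [hCK]
  exact (hKclosed k).mem_of_tendsto (tendsto_pi_nhds.2 fun i => hz i ⟨k, i.2⟩) (hxK k)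

theorem tendsto_addContent_zero_of_isCompactSystem {α : Type*} {C p : Set (Set α)}
    {m : AddContent ℝ≥0∞ C} (hC : IsSetRing C) (hp : IsCompactSystem p) (hpC : p ⊆ C)
    (happrox : ∀ A ∈ C, ∀ ε ≠ 0, ∃ K ∈ p, K ⊆ A ∧ m (A \ K) < ε)
    {A : ℕ → Set α} (hA : ∀ n, A n ∈ C) (hanti : Antitone A) (hinter : ⋂ n, A n = ∅) :
    Tendsto (fun n => m (A n)) atTop (𝓝 0) := by
  refine ENNReal.tendsto_atTop_zero.2 fun ε hε => ?_
  obtain ⟨d, hdpos, hdsum⟩ := ENNReal.exists_pos_sum_of_countable' hε.ne' ℕ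
  choose K hKp hKA hKd using fun n => happrox (A n) (hA n) (d n) (hdpos n).ne'
  obtain ⟨N, hN⟩ := hp K hKp (subset_empty_iff.1 (hinter ▸ iInter_mono hKA))
  have hdiff : ∀ k, A k \ K k ∈ C := fun k => hC.sdiff_mem (hA k) (hpC (hKp k))
  have hcover : A N ⊆ ⋃ k ∈ Finset.range (N + 1), A k \ K k := fun x hx => by
    obtain ⟨k, hk, hxk⟩ : ∃ k ≤ N, x ∉ K k := by
      simpa [dissipate] using eq_empty_iff_forall_notMem.1 hN x
    exact mem_iUnion₂.2 ⟨k, Finset.mem_range_succ_iff.2 hk, hanti hk hx, hxk⟩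
  refine ⟨N, fun n hn => ?_⟩
  calc
    m (A n) ≤ m (⋃ k ∈ Finset.range (N + 1), A k \ K k) :=
      addContent_mono hC.isSetSemiring (hA n) (hC.biUnion_mem _ fun k _ => hdiff k)
        ((hanti hn).trans hcover)
    _ ≤ ∑ k ∈ Finset.range (N + 1), m (A k \ K k) := addContent_biUnion_le hC fun k _ => hdiff k
    _ ≤ ∑ k ∈ Finset.range (N + 1), d k := Finset.sum_le_sum fun k _ => (hKd k).le
    _ ≤ ∑' k, d k := ENNReal.sum_le_tsum _
    _ ≤ ε := hdsum.le

variable {ι : Type*} {X : ι → Type*} [∀ i, MeasurableSpace (X i)]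
  {P : ∀ J : Finset ι, Measure (∀ j : J, X j)}

theorem exists_isProjectiveLimit_of_tendsto_zero [∀ J, IsFiniteMeasure (P J)]
    (hP : IsProjectiveMeasureFamily P)
    (h : ∀ A : ℕ → Set (∀ i, X i), (∀ n, A n ∈ measurableCylinders X) → Antitone A →
      ⋂ n, A n = ∅ → Tendsto (fun n => projectiveFamilyContent hP (A n)) atTop (𝓝 0)) :
    ∃ μ : Measure (∀ i, X i), IsProjectiveLimit μ P := by
  have hsub : (projectiveFamilyContent hP).IsSigmaSubadditive :=
    isSigmaSubadditive_of_addContent_iUnion_eq_tsum isSetRing_measurableCylinders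
      fun f hf hfUnion hdisj => addContent_iUnion_eq_sum_of_tendsto_zero
        isSetRing_measurableCylinders _ (fun _ _ => projectiveFamilyContent_ne_top hP) h
        hf hfUnion hdisj
  refine ⟨(projectiveFamilyContent hP).measure isSetSemiring_measurableCylinders
    generateFrom_measurableCylinders.ge hsub, fun J => ?_⟩
  ext S hS
  rw [Measure.map_apply (Finset.measurable_restrict J) hS, ← cylinder, AddContent.measure_eq,
    projectiveFamilyContent_cylinder hP hS]
  · exact generateFrom_measurableCylinders.symm
  · exact cylinder_mem_measurableCylinders J S hS

theorem exists_isProjectiveLimit [∀ i, TopologicalSpace (X i)] [∀ i, PolishSpace (X i)]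
    [∀ i, BorelSpace (X i)] [∀ J, IsFiniteMeasure (P J)] (hP : IsProjectiveMeasureFamily P) :
    ∃ μ : Measure (∀ i, X i), IsProjectiveLimit μ P := by
  refine exists_isProjectiveLimit_of_tendsto_zero hP fun A hA hanti hinter =>
    tendsto_addContent_zero_of_isCompactSystem isSetRing_measurableCylinders
      (isCompactSystem_closedCompactCylinders X)
      (fun _ => mem_measurableCylinders_of_mem_closedCompactCylinders) ?_ hA hanti hinter
  intro B hB ε hε
  obtain ⟨J, S, hS, rfl⟩ := (mem_measurableCylinders B).1 hB
  obtain ⟨K, hKS, hKcompact, hKclosed, hKε⟩ :=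
    hS.exists_isCompact_isClosed_sdiff_lt (measure_ne_top (P J) S) hε
  refine ⟨cylinder J K, cylinder_mem_closedCompactCylinders J K hKclosed hKcompact,
    preimage_mono hKS, ?_⟩
  rw [sdiff_cylinder_same]
  exact (projectiveFamilyContent_cylinder hP (hS.diff hKclosed.measurableSet)).trans_lt hKε

end KolmogorovExtension

section LinearAlgebra

open Matrix

section CommRing

variable {R m n p : Type*} [CommRing R] [Fintype m] [DecidableEq m] [Fintype n] [Fintype p]
  [DecidableEq p]

theorem toBlocks₁₁_inv_fromBlocks [DecidableEq n] (A : Matrix m m R) (B : Matrix m n R)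
    (C : Matrix n m R) {D : Matrix n n R} (hD : IsUnit D) :
    (fromBlocks A B C D)⁻¹.toBlocks₁₁ = (A - B * D⁻¹ * C)⁻¹ := by
  let := hD.invertible
  rw [← invOf_eq_nonsing_inv D]
  by_cases hS : IsUnit (A - B * ⅟D * C)
  · let := hS.invertible
    let := ((isUnit_fromBlocks_iff_of_invertible₂₂ (A := A) (B := B) (C := C)).2 hS).invertible
    rw [← invOf_eq_nonsing_inv, ← invOf_eq_nonsing_inv, invOf_fromBlocks₂₂_eq,
      toBlocks_fromBlocks₁₁]
  · -- Both sides are then the junk value `0`.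
    have hM := mt isUnit_fromBlocks_iff_of_invertible₂₂.1 hS
    rw [isUnit_iff_isUnit_det] at hS hM
    rw [nonsing_inv_apply_not_isUnit _ hS, nonsing_inv_apply_not_isUnit _ hM]
    rfl

theorem mul_transpose_self_eq_one_sub [DecidableEq n] {g : Matrix p n R} {V : Matrix n m R}
    (hgV : g * V = 0) (hV : Vᵀ * V = 1) (hg : IsUnit (g * gᵀ))
    (hcard : Fintype.card n = Fintype.card m + Fintype.card p) :
    V * Vᵀ = 1 - gᵀ * (g * gᵀ)⁻¹ * g := by
  have hVg : Vᵀ * gᵀ = 0 := by rw [← transpose_mul, hgV, transpose_zero]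
  have hinv : (g * gᵀ)⁻¹ * (g * gᵀ) = 1 :=
    nonsing_inv_mul _ ((isUnit_iff_isUnit_det _).1 hg)
  have hleft : fromRows Vᵀ ((g * gᵀ)⁻¹ * g) * fromCols V gᵀ = 1 := by
    rw [fromRows_mul_fromCols, hV, hVg, Matrix.mul_assoc, hgV, Matrix.mul_zero, Matrix.mul_assoc,
      hinv, fromBlocks_one]
  have hright : fromCols V gᵀ * fromRows Vᵀ ((g * gᵀ)⁻¹ * g) = 1 :=
    (mul_eq_one_comm_of_card_eq n (m ⊕ p) R (by rw [hcard, Fintype.card_sum])).2 hleft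
  rw [← hright, fromCols_mul_fromRows, Matrix.mul_assoc gᵀ, add_sub_cancel_right]

theorem toBlocks₁₁_inv_fromRows_mul_transpose {ι : Type*} [Fintype ι] [DecidableEq ι]
    {g : Matrix p n R} {V : Matrix n m R} (hgV : g * V = 0) (hV : Vᵀ * V = 1)
    (hg : IsUnit (g * gᵀ)) (hcard : Fintype.card n = Fintype.card m + Fintype.card p)
    (G : Matrix ι n R) :
    (fromRows G g * (fromRows G g)ᵀ)⁻¹.toBlocks₁₁ = (G * V * (G * V)ᵀ)⁻¹ := by
  classical
  rw [transpose_fromRows, fromRows_mul_fromCols, toBlocks₁₁_inv_fromBlocks _ _ _ hg]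
  congr 1
  calc
    G * Gᵀ - G * gᵀ * (g * gᵀ)⁻¹ * (g * Gᵀ) = G * (1 - gᵀ * (g * gᵀ)⁻¹ * g) * Gᵀ := by
      simp only [Matrix.mul_sub, Matrix.sub_mul, Matrix.mul_one, Matrix.mul_assoc]
    _ = G * V * (G * V)ᵀ := by
      rw [← mul_transpose_self_eq_one_sub hgV hV hg hcard, transpose_mul]
      simp only [Matrix.mul_assoc]

end CommRing

section Isometry

variable {𝕜 E F : Type*} [RCLike 𝕜] [AddCommGroup E] [Module 𝕜 E]
  [NormedAddCommGroup F] [InnerProductSpace 𝕜 F] [FiniteDimensional 𝕜 F]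

theorem exists_linearIsometry_comp_eq {f g : E →ₗ[𝕜] F} (h : ∀ x, ‖f x‖ = ‖g x‖) :
    ∃ L : F →ₗᵢ[𝕜] F, L.toLinearMap ∘ₗ f = g := by
  have hker : LinearMap.ker f ≤ LinearMap.ker g := fun x hx => by
    rw [LinearMap.mem_ker, ← norm_eq_zero, ← h, LinearMap.mem_ker.1 hx, norm_zero]
  obtain ⟨σ, hσ⟩ := f.rangeRestrict.exists_rightInverse_of_surjective f.range_rangeRestrict
  have hfσ : ∀ s, f (σ s) = s := fun s => congrArg Subtype.val (LinearMap.congr_fun hσ s)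
  let L : LinearMap.range f →ₗᵢ[𝕜] F :=
    { toLinearMap := g ∘ₗ σ
      norm_map' := fun s => (h (σ s)).symm.trans (congrArg norm (hfσ s)) }
  refine ⟨L.extend, LinearMap.ext fun x => ?_⟩
  have hLx : L.extend (f x) = g (σ (f.rangeRestrict x)) := L.extend_apply (f.rangeRestrict x)
  have hx : σ (f.rangeRestrict x) - x ∈ LinearMap.ker f := by
    rw [LinearMap.mem_ker, map_sub, hfσ, sub_eq_zero]
    rfl
  exact hLx.trans (sub_eq_zero.1 ((map_sub g _ _).symm.trans (hker hx)))

end Isometry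

section Real

variable {m n p : Type*} [Fintype m] [DecidableEq m] [Fintype n] [Finite p]

theorem exists_transpose_mul_self_eq_one_mul_eq_zero (g : Matrix p n ℝ)
    (hcard : Fintype.card n = Fintype.card m + g.rank) :
    ∃ V : Matrix n m ℝ, g * V = 0 ∧ Vᵀ * V = 1 := by
  classical
  have := Fintype.ofFinite p
  let K := LinearMap.ker (toEuclideanLin g)
  have hK : Module.finrank ℝ K = Fintype.card m := by
    have hrank : g.rank = Module.finrank ℝ (LinearMap.range (toEuclideanLin g)) := by
      rw [toEuclideanLin, toLpLin_eq_toLin, ← rank_eq_finrank_range_toLin]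
    have h := (toEuclideanLin g).finrank_range_add_finrank_ker
    rw [← hrank, finrank_euclideanSpace, hcard, add_comm (Fintype.card m)] at h
    exact Nat.add_left_cancel h
  let b : OrthonormalBasis m ℝ K := (stdOrthonormalBasis ℝ K).reindex
    ((finCongr hK).trans (Fintype.equivFin m).symm)
  refine ⟨Matrix.of fun i j => (b j : EuclideanSpace ℝ n) i, ?_, ?_⟩
  · ext i j
    exact congrArg (fun v : EuclideanSpace ℝ p => v i) (LinearMap.mem_ker.1 (b j).2)
  · ext i j
    rw [one_apply, ← orthonormal_iff_ite.1 b.orthonormal i j]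
    exact dotProduct_comm _ _

theorem exists_mem_orthogonalGroup_mul_eq {A B : Matrix p m ℝ} (h : A * Aᵀ = B * Bᵀ) :
    ∃ O ∈ orthogonalGroup m ℝ, A * O = B := by
  classical
  have := Fintype.ofFinite p
  have norm_sq_eq (C : Matrix p m ℝ) (x : EuclideanSpace ℝ p) :
      ‖toEuclideanLin Cᵀ x‖ ^ 2 = x.ofLp ⬝ᵥ (C * Cᵀ) *ᵥ x.ofLp := by
    rw [← real_inner_self_eq_norm_sq, EuclideanSpace.inner_eq_star_dotProduct, star_trivial,
      ← mulVec_mulVec, dotProduct_mulVec, ← mulVec_transpose, ofLp_toLpLin, toLin'_apply]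
  have hnorm (x : EuclideanSpace ℝ p) : ‖toEuclideanLin Aᵀ x‖ = ‖toEuclideanLin Bᵀ x‖ :=
    (sq_eq_sq₀ (norm_nonneg _) (norm_nonneg _)).1 (by rw [norm_sq_eq, norm_sq_eq, h])
  obtain ⟨L, hL⟩ := exists_linearIsometry_comp_eq hnorm
  let R := toEuclideanLin.symm L.toLinearMap
  have hLR : toEuclideanLin R = L.toLinearMap := toEuclideanLin.apply_symm_apply _
  have hRA : R * Aᵀ = Bᵀ := toEuclideanLin.injective (by rw [toLpLin_mul_same, hLR, hL])
  have hRR : Rᵀ * R = 1 := toEuclideanLin.injective (by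
    rw [toLpLin_mul_same, toLpLin_one, ← conjTranspose_eq_transpose_of_trivial,
      toEuclideanLin_conjTranspose_eq_adjoint, hLR, L.adjoint_comp_self'])
  refine ⟨Rᵀ, (mem_orthogonalGroup_iff m ℝ).2 hRR, ?_⟩
  rw [← transpose_inj, transpose_mul, transpose_transpose, hRA]

end Real

end LinearAlgebra

section Measurability

open Matrix

variable {α l m n p : Type*}

instance borelSpace_matrix [Countable m] [Countable n] : BorelSpace (Matrix m n ℝ) :=
  inferInstanceAs (BorelSpace (m → n → ℝ))

theorem measurable_matrix_iff [MeasurableSpace α] {f : α → Matrix m n ℝ} :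
    Measurable f ↔ ∀ i j, Measurable fun a => f a i j :=
  measurable_pi_iff.trans (forall_congr' fun _ => measurable_pi_iff)

variable [MeasurableSpace α] {f : α → Matrix m n ℝ}

@[fun_prop]
theorem measurable_matrix_transpose (hf : Measurable f) : Measurable fun a => (f a)ᵀ :=
  measurable_matrix_iff.2 fun i j => measurable_matrix_iff.1 hf j i

@[fun_prop]
theorem measurable_matrix_submatrix (hf : Measurable f) (r : l → m) (c : p → n) :
    Measurable fun a => (f a).submatrix r c :=
  measurable_matrix_iff.2 fun i j => measurable_matrix_iff.1 hf (r i) (c j)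

@[fun_prop]
theorem measurable_matrix_toBlocks₁₁ {f : α → Matrix (l ⊕ m) (n ⊕ p) ℝ} (hf : Measurable f) :
    Measurable fun a => (f a).toBlocks₁₁ :=
  measurable_matrix_submatrix hf Sum.inl Sum.inl

@[fun_prop]
theorem measurable_matrix_mul [Fintype n] {g : α → Matrix n p ℝ} (hf : Measurable f)
    (hg : Measurable g) : Measurable fun a => f a * g a :=
  measurable_matrix_iff.2 fun i j => by
    simp only [mul_apply]
    fun_prop

@[fun_prop]
theorem measurable_matrix_inv [Fintype n] [DecidableEq n] {f : α → Matrix n n ℝ}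
    (hf : Measurable f) : Measurable fun a => (f a)⁻¹ := by
  have hdet : Measurable fun a => (f a).det := continuous_id.matrix_det.measurable.comp hf
  have hadj : Measurable fun a => (f a).adjugate := continuous_id.matrix_adjugate.measurable.comp hf
  refine measurable_matrix_iff.2 fun i j => ?_
  simp only [inv_def, Ring.inverse_eq_inv, Matrix.smul_apply, smul_eq_mul]
  exact hdet.inv.mul (measurable_matrix_iff.1 hadj i j)

@[fun_prop]
theorem measurable_fromRows {l : Type*} {g : α → Matrix l n ℝ} (hf : Measurable f)
    (hg : Measurable g) : Measurable fun a => fromRows (f a) (g a) :=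
  measurable_matrix_iff.2 <| Sum.rec (measurable_matrix_iff.1 hf) (measurable_matrix_iff.1 hg)

end Measurability

section GaussianMatrix

open Matrix

section stdGaussian

variable {E F : Type*} [NormedAddCommGroup E] [InnerProductSpace ℝ E] [FiniteDimensional ℝ E]
  [MeasurableSpace E] [BorelSpace E] [NormedAddCommGroup F] [InnerProductSpace ℝ F]
  [FiniteDimensional ℝ F] [MeasurableSpace F] [BorelSpace F]

theorem stdGaussian_map_of_norm_adjoint {L : E →ₗ[ℝ] F} (hL : ∀ t, ‖L.adjoint t‖ = ‖t‖) :
    (stdGaussian E).map L = stdGaussian F := by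
  have hLm : Measurable L := L.continuous_of_finiteDimensional.measurable
  have := Measure.isProbabilityMeasure_map (μ := stdGaussian E) hLm.aemeasurable
  refine Measure.ext_of_charFun (funext fun t => ?_)
  rw [charFun_apply, integral_map hLm.aemeasurable (by fun_prop)]
  simp only [← LinearMap.adjoint_inner_right]
  rw [← charFun_apply, charFun_stdGaussian, charFun_stdGaussian, hL]

theorem map_ofLp_stdGaussian (ι : Type*) [Fintype ι] :
    (stdGaussian (EuclideanSpace ℝ ι)).map WithLp.ofLp =
      Measure.pi fun _ : ι => gaussianReal 0 1 := by
  rw [← map_pi_eq_stdGaussian, Measure.map_map (by fun_prop) (by fun_prop)]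
  exact Measure.map_id

end stdGaussian

theorem pi_gaussianReal_map_mulVec {m n : Type*} [Fintype m] [DecidableEq m] [Fintype n]
    {A : Matrix m n ℝ} (hA : A * Aᵀ = 1) :
    (Measure.pi fun _ : n => gaussianReal 0 1).map (A *ᵥ ·) =
      Measure.pi fun _ : m => gaussianReal 0 1 := by
  classical
  have hnorm (t : EuclideanSpace ℝ m) : ‖(toEuclideanLin A).adjoint t‖ = ‖t‖ := by
    have hcomp : toEuclideanLin A ∘ₗ (toEuclideanLin A).adjoint = LinearMap.id := by
      rw [← toEuclideanLin_conjTranspose_eq_adjoint, conjTranspose_eq_transpose_of_trivial,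
        toEuclideanLin, ← toLpLin_mul, hA, toLpLin_one]
    rw [← sq_eq_sq₀ (norm_nonneg _) (norm_nonneg _), ← real_inner_self_eq_norm_sq,
      ← real_inner_self_eq_norm_sq, LinearMap.adjoint_inner_left, ← LinearMap.comp_apply, hcomp,
      LinearMap.id_apply]
  rw [← map_ofLp_stdGaussian n, ← map_ofLp_stdGaussian m, ← stdGaussian_map_of_norm_adjoint hnorm,
    Measure.map_map (by fun_prop) (by fun_prop), Measure.map_map (by fun_prop) (by fun_prop)]
  rfl

/-- The law of a `ι × κ` matrix with independent standard Gaussian entries. -/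
noncomputable def gaussianMatrix (ι κ : Type*) [Fintype ι] [Fintype κ] : Measure (Matrix ι κ ℝ) :=
  (Measure.pi fun _ => Measure.pi fun _ => gaussianReal 0 1 : Measure (ι → κ → ℝ))

instance isProbabilityMeasure_gaussianMatrix (ι κ : Type*) [Fintype ι] [Fintype κ] :
    IsProbabilityMeasure (gaussianMatrix ι κ) :=
  inferInstanceAs (IsProbabilityMeasure
    (Measure.pi fun _ => Measure.pi fun _ => gaussianReal 0 1 : Measure (ι → κ → ℝ)))

variable {ι ι' κ κ' : Type*} [Fintype ι] [Fintype ι'] [Fintype κ] [Fintype κ']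

theorem pi_gaussianReal_map_of (ι κ : Type*) [Fintype ι] [Fintype κ] :
    (Measure.pi fun _ : ι × κ => gaussianReal 0 1).map (fun x => Matrix.of fun i j => x (i, j)) =
      gaussianMatrix ι κ := by
  have h := Measure.infinitePi_map_curry fun (_ : ι) (_ : κ) => gaussianReal 0 1
  simp only [Measure.infinitePi_eq_pi] at h
  exact h

theorem gaussianMatrix_map_of_equiv (σ : ι' × κ' ≃ ι × κ) :
    (gaussianMatrix ι κ).map (fun Y => Matrix.of fun i j => Y (σ (i, j)).1 (σ (i, j)).2) =
      gaussianMatrix ι' κ' := by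
  have hσ := (measurePreserving_arrowCongr' (fun _ => gaussianReal 0 1)
    (fun _ => gaussianReal 0 1) σ.symm (MeasurableEquiv.refl ℝ)
    fun _ => MeasurePreserving.id _).map_eq
  rw [← pi_gaussianReal_map_of ι κ, ← pi_gaussianReal_map_of ι' κ', ← hσ,
    Measure.map_map (by fun_prop) (by fun_prop), Measure.map_map (by fun_prop) (by fun_prop)]
  rfl

theorem gaussianMatrix_map_transpose :
    (gaussianMatrix ι κ).map (fun Y => Yᵀ) = gaussianMatrix κ ι :=
  gaussianMatrix_map_of_equiv (Equiv.prodComm κ ι)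

theorem gaussianMatrix_map_submatrix (e : ι' ≃ ι) (f : κ' ≃ κ) :
    (gaussianMatrix ι κ).map (fun Y => Y.submatrix e f) = gaussianMatrix ι' κ' :=
  gaussianMatrix_map_of_equiv (e.prodCongr f)

theorem gaussianMatrix_map_mul_right [DecidableEq κ'] {V : Matrix κ κ' ℝ} (hV : Vᵀ * V = 1) :
    (gaussianMatrix ι κ).map (fun Y => Y * V) = gaussianMatrix ι κ' := by
  have hrow : (Measure.pi fun _ : κ => gaussianReal 0 1).map (fun x => x ᵥ* V) =
      Measure.pi fun _ : κ' => gaussianReal 0 1 := by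
    simpa only [mulVec_transpose] using
      pi_gaussianReal_map_mulVec (A := Vᵀ) (by rwa [transpose_transpose])
  have : IsProbabilityMeasure ((Measure.pi fun _ : κ => gaussianReal 0 1).map fun x => x ᵥ* V) :=
    hrow ▸ inferInstance
  have h := Measure.pi_map_pi (μ := fun _ : ι => Measure.pi fun _ : κ => gaussianReal 0 1)
    (f := fun _ x => x ᵥ* V) fun _ => by fun_prop
  simp only [hrow] at h
  exact h

theorem gaussianMatrix_map_mul_left [DecidableEq ι'] {A : Matrix ι' ι ℝ} (hA : A * Aᵀ = 1) :
    (gaussianMatrix ι κ).map (fun Y => A * Y) = gaussianMatrix ι' κ := by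
  rw [← gaussianMatrix_map_transpose (ι := κ), ← gaussianMatrix_map_transpose (ι := κ),
    ← gaussianMatrix_map_mul_right (V := Aᵀ) (by rwa [transpose_transpose]),
    Measure.map_map (by fun_prop) (by fun_prop), Measure.map_map (by fun_prop) (by fun_prop)]
  simp only [Function.comp_def, transpose_mul, transpose_transpose]

theorem prod_gaussianMatrix_map_fromRows :
    ((gaussianMatrix ι κ).prod (gaussianMatrix ι' κ)).map (fun p => fromRows p.1 p.2) =
      gaussianMatrix (ι ⊕ ι') κ :=
  (measurePreserving_sumPiEquivProdPi_symm
    fun _ : ι ⊕ ι' => Measure.pi fun _ : κ => gaussianReal 0 1).map_eq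

theorem gaussianMatrix_ae_ne [Nonempty ι] [Nonempty κ] (M : Matrix ι κ ℝ) :
    ∀ᵐ Y ∂gaussianMatrix ι κ, Y ≠ M := by
  have : NullSingletonClass (gaussianReal 0 1) := nullSingletonClass_gaussianReal one_ne_zero
  have : NullSingletonClass (Measure.pi fun _ : κ => gaussianReal 0 1) :=
    Measure.pi_nullSingletonClass'
  have : NullSingletonClass (gaussianMatrix ι κ) :=
    Measure.pi_nullSingletonClass' (μ := fun _ : ι => Measure.pi fun _ : κ => gaussianReal 0 1)
  exact Measure.ae_ne _ M

end GaussianMatrix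

section InverseGramGaussian

open Matrix

theorem map_prod_eq_of_ae_map_eq {α β γ : Type*} [MeasurableSpace α] [MeasurableSpace β]
    [MeasurableSpace γ] {μ : Measure α} [SFinite μ] {ν : Measure β} [IsProbabilityMeasure ν]
    {ρ : Measure γ} {f : α × β → γ} (hf : Measurable f)
    (h : ∀ᵐ b ∂ν, μ.map (fun a => f (a, b)) = ρ) : (μ.prod ν).map f = ρ := by
  ext s hs
  have hslice : ∀ᵐ b ∂ν, μ ((fun a => (a, b)) ⁻¹' (f ⁻¹' s)) = ρ s := by
    filter_upwards [h] with b hb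
    rw [← hb, Measure.map_apply (by fun_prop) hs]
    rfl
  rw [Measure.map_apply hf hs, Measure.prod_apply_symm (hf hs), lintegral_congr_ae hslice,
    lintegral_const, measure_univ, mul_one]

variable {ι ι' κ κ' τ : Type*} [Fintype ι] [DecidableEq ι] [Fintype ι'] [DecidableEq ι']
  [Fintype κ] [Fintype κ'] [Fintype τ] [DecidableEq τ]

/-- The law of `(Y * Yᵀ)⁻¹`, where `Y` is an `ι × κ` matrix with independent standard Gaussian
entries. It is `IW(δ, 1)` when `κ` has `δ + card ι - 1` elements; keeping an arbitrary `κ` allows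
degrees of freedom to be counted in bijection with rows. -/
noncomputable def inverseGramGaussian (ι κ : Type*) [Fintype ι] [DecidableEq ι] [Fintype κ] :
    Measure (Matrix ι ι ℝ) :=
  (gaussianMatrix ι κ).map fun Y => (Y * Yᵀ)⁻¹

instance isProbabilityMeasure_inverseGramGaussian :
    IsProbabilityMeasure (inverseGramGaussian ι κ) :=
  Measure.isProbabilityMeasure_map (by fun_prop)

theorem inverseGramGaussian_map_submatrix_equiv (e : ι' ≃ ι) (f : κ' ≃ κ) :
    (inverseGramGaussian ι κ).map (fun W => W.submatrix e e) = inverseGramGaussian ι' κ' := by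
  rw [inverseGramGaussian, inverseGramGaussian, ← gaussianMatrix_map_submatrix e f,
    Measure.map_map (by fun_prop) (by fun_prop), Measure.map_map (by fun_prop) (by fun_prop)]
  congr 1
  ext1 Y
  simp only [Function.comp_apply, transpose_submatrix, submatrix_mul_equiv, inv_submatrix_equiv]

theorem inverseGramGaussian_map_conj {O : Matrix ι ι ℝ} (hO : O * Oᵀ = 1) :
    (inverseGramGaussian ι κ).map (fun W => O * W * Oᵀ) = inverseGramGaussian ι κ := by
  conv_rhs => rw [inverseGramGaussian, ← gaussianMatrix_map_mul_left hO]
  rw [inverseGramGaussian, Measure.map_map (by fun_prop) (by fun_prop),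
    Measure.map_map (by fun_prop) (by fun_prop)]
  congr 1
  ext1 Y
  have hY : O * Y * (O * Y)ᵀ = O * (Y * Yᵀ) * Oᵀ := by
    simp only [transpose_mul, Matrix.mul_assoc]
  simp only [Function.comp_apply]
  rw [hY, Matrix.mul_inv_rev, Matrix.mul_inv_rev, inv_eq_right_inv hO, inv_eq_left_inv hO,
    Matrix.mul_assoc]

theorem isUnit_mul_transpose_of_unique [Unique τ] {g : Matrix τ κ ℝ} (hg : g ≠ 0) :
    IsUnit (g * gᵀ) := by
  have hgram : g * gᵀ ≠ 0 := by
    rwa [← conjTranspose_eq_transpose_of_trivial, Ne, self_mul_conjTranspose_eq_zero]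
  rw [isUnit_iff_isUnit_det, det_unique, isUnit_iff_ne_zero]
  exact fun h => hgram (ext fun i j => by rwa [Unique.eq_default i, Unique.eq_default j])

theorem inverseGramGaussian_map_toBlocks₁₁_of_unique [Unique τ]
    (hcard : Fintype.card κ' = Fintype.card κ + 1) :
    (inverseGramGaussian (ι ⊕ τ) κ').map toBlocks₁₁ = inverseGramGaussian ι κ := by
  classical
  have : Nonempty κ' := Fintype.card_pos_iff.1 (by lia)
  rw [inverseGramGaussian, ← prod_gaussianMatrix_map_fromRows,
    Measure.map_map (by fun_prop) (by fun_prop), Measure.map_map (by fun_prop) (by fun_prop)]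
  refine map_prod_eq_of_ae_map_eq (by fun_prop) ?_
  filter_upwards [gaussianMatrix_ae_ne (0 : Matrix τ κ' ℝ)] with g hg
  have hgram := isUnit_mul_transpose_of_unique hg
  have hrank : g.rank = 1 := by
    rw [← rank_self_mul_transpose, rank_of_isUnit _ hgram, Fintype.card_unique]
  obtain ⟨V, hgV, hV⟩ :=
    exists_transpose_mul_self_eq_one_mul_eq_zero (m := κ) g (by rw [hrank, hcard])
  rw [inverseGramGaussian, ← gaussianMatrix_map_mul_right hV,
    Measure.map_map (by fun_prop) (by fun_prop)]
  congr 1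
  ext1 G
  exact toBlocks₁₁_inv_fromRows_mul_transpose hgV hV hgram
    (by simp only [hcard, Fintype.card_unique]) G

theorem inverseGramGaussian_map_toBlocks₁₁ (n : ℕ) :
    (inverseGramGaussian (ι ⊕ Fin n) (κ ⊕ Fin n)).map toBlocks₁₁ = inverseGramGaussian ι κ := by
  induction n with
  | zero =>
    exact inverseGramGaussian_map_submatrix_equiv (Equiv.sumEmpty ι (Fin 0)).symm
      (Equiv.sumEmpty κ (Fin 0)).symm
  | succ n ih =>
    let e : (ι ⊕ Fin n) ⊕ Fin 1 ≃ ι ⊕ Fin (n + 1) :=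
      (Equiv.sumAssoc ι (Fin n) (Fin 1)).trans ((Equiv.refl ι).sumCongr finSumFinEquiv)
    rw [← ih, ← inverseGramGaussian_map_toBlocks₁₁_of_unique (τ := Fin 1) (κ := κ ⊕ Fin n)
        (κ' := κ ⊕ Fin (n + 1)) (by simp only [Fintype.card_sum, Fintype.card_fin, add_assoc]),
      ← inverseGramGaussian_map_submatrix_equiv e (Equiv.refl _),
      Measure.map_map (by fun_prop) (by fun_prop), Measure.map_map (by fun_prop) (by fun_prop)]
    rfl

theorem inverseGramGaussian_map_submatrix {e : ι' → ι} (he : Function.Injective e)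
    (hcard : Fintype.card ι + Fintype.card κ' = Fintype.card ι' + Fintype.card κ) :
    (inverseGramGaussian ι κ).map (fun W => W.submatrix e e) = inverseGramGaussian ι' κ' := by
  classical
  let n := Fintype.card ((Set.range e)ᶜ : Set ι)
  let E : ι' ⊕ Fin n ≃ ι :=
    ((Equiv.ofInjective e he).sumCongr (Fintype.equivFin _).symm).trans
      (Equiv.Set.sumCompl (Set.range e))
  have hι := Fintype.card_congr E
  let F : κ' ⊕ Fin n ≃ κ := Fintype.equivOfCardEq (by
    rw [Fintype.card_sum] at hι ⊢
    lia)
  rw [← inverseGramGaussian_map_toBlocks₁₁ (ι := ι') n,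
    ← inverseGramGaussian_map_submatrix_equiv E F,
    Measure.map_map (by fun_prop) (by fun_prop)]
  rfl

end InverseGramGaussian

section InverseWishart

open Matrix
open scoped MatrixOrder

theorem sum_vecMulVec_mulVec {R l m n : Type*} [CommSemiring R] [Fintype m] [Fintype n]
    (A : Matrix l n R) (X : Matrix m n R) :
    ∑ k, vecMulVec (A *ᵥ X k) (A *ᵥ X k) = A * (Xᵀ * X) * Aᵀ := by
  have hA : A * (Xᵀ * X) * Aᵀ = (X * Aᵀ)ᵀ * (X * Aᵀ) := by
    simp only [transpose_mul, transpose_transpose, Matrix.mul_assoc]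
  rw [hA]
  ext i j
  simp only [Matrix.sum_apply, vecMulVec_apply, ← vecMul_transpose, ← mul_apply_eq_vecMul]
  simp only [mul_apply, transpose_apply]

theorem submatrix_eq_mul_mul_transpose {R m n : Type*} [CommSemiring R] [Fintype m] [DecidableEq m]
    (M : Matrix m m R) (e : n → m) :
    M.submatrix e e =
      (1 : Matrix m m R).submatrix e id * M * ((1 : Matrix m m R).submatrix e id)ᵀ := by
  ext i j
  simp [mul_apply, one_apply]

theorem one_submatrix_mul_transpose {R m n : Type*} [CommSemiring R] [Fintype m] [DecidableEq m]
    [DecidableEq n] {e : n → m} (he : Function.Injective e) :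
    (1 : Matrix m m R).submatrix e id * ((1 : Matrix m m R).submatrix e id)ᵀ = 1 := by
  have h := submatrix_eq_mul_mul_transpose (1 : Matrix m m R) e
  rwa [submatrix_one e he, Matrix.mul_one, eq_comm] at h

variable {ι κ : Type*} [Fintype ι] [DecidableEq ι] [Fintype κ]

theorem transpose_cfcSqrt (S : Matrix ι ι ℝ) : (CFC.sqrt S)ᵀ = CFC.sqrt S := by
  rw [← conjTranspose_eq_transpose_of_trivial, ← star_eq_conjTranspose]
  exact (CFC.sqrt_nonneg S).isSelfAdjoint

theorem cfcSqrt_mul_transpose {S : Matrix ι ι ℝ} (hS : S.PosSemidef) :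
    CFC.sqrt S * (CFC.sqrt S)ᵀ = S := by
  rw [transpose_cfcSqrt, CFC.sqrt_mul_sqrt_self S hS.nonneg]

theorem multivariateGaussian_zero_eq_map (S : Matrix ι ι ℝ) :
    multivariateGaussian 0 S =
      (Measure.pi fun _ : ι => gaussianReal 0 1).map fun x => WithLp.toLp 2 (CFC.sqrt S *ᵥ x) := by
  rw [multivariateGaussian, ← map_pi_eq_stdGaussian, Measure.map_map (by fun_prop) (by fun_prop)]
  congr 1
  ext1 x
  simp only [Function.comp_apply, zero_add]
  rfl

theorem pi_multivariateGaussian_zero_eq_map (κ : Type*) [Fintype κ] (S : Matrix ι ι ℝ) :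
    (Measure.pi fun _ : κ => multivariateGaussian 0 S) =
      (gaussianMatrix κ ι).map fun X k => WithLp.toLp 2 (CFC.sqrt S *ᵥ X k) := by
  have hsqrt : Measurable fun x : ι → ℝ =>
      (WithLp.toLp 2 (CFC.sqrt S *ᵥ x) : EuclideanSpace ℝ ι) := by fun_prop
  have : IsProbabilityMeasure ((Measure.pi fun _ : ι => gaussianReal 0 1).map
      fun x => (WithLp.toLp 2 (CFC.sqrt S *ᵥ x) : EuclideanSpace ℝ ι)) :=
    Measure.isProbabilityMeasure_map hsqrt.aemeasurable
  rw [multivariateGaussian_zero_eq_map]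
  exact (Measure.pi_map_pi fun _ => hsqrt.aemeasurable).symm

theorem wishart_eq_map_gaussianMatrix (ν : ℕ) (S : Matrix ι ι ℝ) :
    wishart ν S = (gaussianMatrix ι (Fin ν)).map
      fun Y => CFC.sqrt S * (Y * Yᵀ) * (CFC.sqrt S)ᵀ := by
  have hsum : Measurable fun x : Fin ν → EuclideanSpace ℝ ι =>
      ∑ k, vecMulVec (x k).ofLp (x k).ofLp := measurable_matrix_iff.2 fun i j => by
    simp only [Matrix.sum_apply, vecMulVec_apply]
    fun_prop
  have hsqrt : Measurable fun x : ι → ℝ =>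
      (WithLp.toLp 2 (CFC.sqrt S *ᵥ x) : EuclideanSpace ℝ ι) := by fun_prop
  have hrow : Measurable fun (X : Matrix (Fin ν) ι ℝ) k =>
      (WithLp.toLp 2 (CFC.sqrt S *ᵥ X k) : EuclideanSpace ℝ ι) :=
    measurable_pi_lambda _ fun k => hsqrt.comp (measurable_pi_apply k)
  rw [wishart, pi_multivariateGaussian_zero_eq_map, Measure.map_map hsum hrow,
    ← gaussianMatrix_map_transpose (ι := Fin ν), Measure.map_map (by fun_prop) (by fun_prop)]
  congr 1
  ext1 X
  exact sum_vecMulVec_mulVec (CFC.sqrt S) X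

theorem inverseWishartOfPosDef_eq_map (δ : ℕ) (Ψ : Matrix ι ι ℝ) :
    inverseWishartOfPosDef δ Ψ = (inverseGramGaussian ι (Fin (δ + Fintype.card ι - 1))).map
      fun W => (CFC.sqrt Ψ⁻¹)⁻¹ * W * ((CFC.sqrt Ψ⁻¹)⁻¹)ᵀ := by
  rw [inverseWishartOfPosDef, wishart_eq_map_gaussianMatrix, inverseGramGaussian,
    Measure.map_map (by fun_prop) (by fun_prop), Measure.map_map (by fun_prop) (by fun_prop)]
  congr 1
  ext1 Y
  simp only [Function.comp_apply]
  rw [Matrix.mul_inv_rev, Matrix.mul_inv_rev, transpose_nonsing_inv, transpose_cfcSqrt,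
    Matrix.mul_assoc]

theorem inverseWishartOfPosDef_one (δ : ℕ) :
    inverseWishartOfPosDef δ (1 : Matrix ι ι ℝ) =
      inverseGramGaussian ι (Fin (δ + Fintype.card ι - 1)) := by
  rw [inverseWishartOfPosDef_eq_map]
  simp

theorem inverseWishart_one (δ : ℕ) :
    inverseWishart δ (1 : Matrix ι ι ℝ) = inverseGramGaussian ι (Fin (δ + Fintype.card ι - 1)) := by
  rw [inverseWishart, if_pos PosDef.one, inverseWishartOfPosDef_one]

instance isProbabilityMeasure_inverseWishart (δ : ℕ) (Ψ : Matrix ι ι ℝ) :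
    IsProbabilityMeasure (inverseWishart δ Ψ) := by
  rw [inverseWishart, inverseWishartOfPosDef_one, inverseWishartOfPosDef_eq_map]
  split_ifs <;> exact Measure.isProbabilityMeasure_map (by fun_prop)

theorem exists_mul_transpose_eq_inverseWishart_eq_map (δ : ℕ) {Ψ : Matrix ι ι ℝ}
    (hΨ : Ψ.PosSemidef) :
    ∃ B : Matrix ι ι ℝ, B * Bᵀ = Ψ ∧
      inverseWishart δ Ψ = (inverseWishart δ (1 : Matrix ι ι ℝ)).map fun W => B * W * Bᵀ := by
  rw [inverseWishart_one]
  by_cases hdef : Ψ.PosDef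
  · refine ⟨(CFC.sqrt Ψ⁻¹)⁻¹, ?_, ?_⟩
    · rw [transpose_nonsing_inv, ← Matrix.mul_inv_rev, transpose_cfcSqrt,
        CFC.sqrt_mul_sqrt_self _ hdef.inv.posSemidef.nonneg,
        nonsing_inv_nonsing_inv _ ((isUnit_iff_isUnit_det _).1 hdef.isUnit)]
    · rw [inverseWishart, if_pos hdef, inverseWishartOfPosDef_eq_map]
  · refine ⟨CFC.sqrt Ψ, cfcSqrt_mul_transpose hΨ, ?_⟩
    rw [inverseWishart, if_neg hdef, inverseWishartOfPosDef_one, transpose_cfcSqrt]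

variable {ι' κ' : Type*} [Fintype ι'] [DecidableEq ι'] [DecidableEq κ] [Fintype κ']
  [DecidableEq κ'] {δ : ℕ}

theorem inverseWishart_one_map_submatrix (hδ : 0 < δ) {e : ι' → ι} (he : Function.Injective e) :
    (inverseWishart δ (1 : Matrix ι ι ℝ)).map (fun W => W.submatrix e e) =
      inverseWishart δ (1 : Matrix ι' ι' ℝ) := by
  rw [inverseWishart_one, inverseWishart_one]
  refine inverseGramGaussian_map_submatrix he ?_
  simp only [Fintype.card_fin]
  lia

theorem inverseWishart_one_map_conj_orthogonal {O : Matrix ι ι ℝ} (hO : O ∈ orthogonalGroup ι ℝ) :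
    (inverseWishart δ (1 : Matrix ι ι ℝ)).map (fun W => O * W * Oᵀ) =
      inverseWishart δ (1 : Matrix ι ι ℝ) := by
  rw [inverseWishart_one, inverseGramGaussian_map_conj ((mem_orthogonalGroup_iff ι ℝ).1 hO)]

theorem exists_inverseWishart_one_map_conj_eq {q : Type*} (hδ : 0 < δ) {e : κ → κ'}
    (he : Function.Injective e) (A : Matrix q κ ℝ) :
    ∃ A' : Matrix q κ' ℝ, A' * A'ᵀ = A * Aᵀ ∧
      (inverseWishart δ (1 : Matrix κ κ ℝ)).map (fun W => A * W * Aᵀ) =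
        (inverseWishart δ (1 : Matrix κ' κ' ℝ)).map fun W => A' * W * A'ᵀ := by
  let P : Matrix κ κ' ℝ := (1 : Matrix κ' κ' ℝ).submatrix e id
  have hconj (W : Matrix κ' κ' ℝ) : A * W.submatrix e e * Aᵀ = A * P * W * (A * P)ᵀ := by
    simp only [P, submatrix_eq_mul_mul_transpose W e, transpose_mul, Matrix.mul_assoc]
  refine ⟨A * P, ?_, ?_⟩
  · rw [transpose_mul, Matrix.mul_assoc, ← Matrix.mul_assoc P, one_submatrix_mul_transpose he,
      Matrix.one_mul]
  · rw [← inverseWishart_one_map_submatrix hδ he, Measure.map_map (by fun_prop) (by fun_prop)]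
    exact congrArg (Measure.map · _) (funext hconj)

-- Both factors are extended to `κ ⊕ κ'` columns, where they differ by a rotation.
theorem inverseWishart_one_map_conj_eq {q : Type*} [Finite q] (hδ : 0 < δ) {A : Matrix q κ ℝ}
    {B : Matrix q κ' ℝ} (h : A * Aᵀ = B * Bᵀ) :
    (inverseWishart δ (1 : Matrix κ κ ℝ)).map (fun W => A * W * Aᵀ) =
      (inverseWishart δ (1 : Matrix κ' κ' ℝ)).map fun W => B * W * Bᵀ := by
  obtain ⟨A', hA', hlawA⟩ :=
    exists_inverseWishart_one_map_conj_eq hδ (Sum.inl_injective (β := κ')) A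
  obtain ⟨B', hB', hlawB⟩ :=
    exists_inverseWishart_one_map_conj_eq hδ (Sum.inr_injective (α := κ)) B
  obtain ⟨O, hO, rfl⟩ := exists_mem_orthogonalGroup_mul_eq (hA'.trans (h.trans hB'.symm))
  rw [hlawA, hlawB]
  conv_lhs => rw [← inverseWishart_one_map_conj_orthogonal hO,
    Measure.map_map (by fun_prop) (by fun_prop)]
  simp only [Function.comp_def, transpose_mul, Matrix.mul_assoc]

theorem inverseWishart_mul_transpose (hδ : 0 < δ) (B : Matrix ι κ ℝ) :
    inverseWishart δ (B * Bᵀ) =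
      (inverseWishart δ (1 : Matrix κ κ ℝ)).map fun W => B * W * Bᵀ := by
  obtain ⟨C, hC, hlaw⟩ := exists_mul_transpose_eq_inverseWishart_eq_map δ
    (posSemidef_self_mul_conjTranspose B)
  rw [conjTranspose_eq_transpose_of_trivial] at hC hlaw
  rw [hlaw, inverseWishart_one_map_conj_eq hδ hC]

theorem inverseWishart_map_conj (hδ : 0 < δ) {Ψ : Matrix κ κ ℝ} (hΨ : Ψ.PosSemidef)
    (A : Matrix ι κ ℝ) :
    (inverseWishart δ Ψ).map (fun W => A * W * Aᵀ) = inverseWishart δ (A * Ψ * Aᵀ) := by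
  obtain ⟨B, rfl⟩ : ∃ B : Matrix κ κ ℝ, B * Bᵀ = Ψ := ⟨_, cfcSqrt_mul_transpose hΨ⟩
  have hAB : A * (B * Bᵀ) * Aᵀ = A * B * (A * B)ᵀ := by
    simp only [transpose_mul, Matrix.mul_assoc]
  rw [hAB, inverseWishart_mul_transpose hδ, inverseWishart_mul_transpose hδ,
    Measure.map_map (by fun_prop) (by fun_prop)]
  simp only [Function.comp_def, transpose_mul, Matrix.mul_assoc]

theorem inverseWishart_map_submatrix (hδ : 0 < δ) {Ψ : Matrix ι ι ℝ} (hΨ : Ψ.PosSemidef)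
    (e : ι' → ι) :
    (inverseWishart δ Ψ).map (fun W => W.submatrix e e) = inverseWishart δ (Ψ.submatrix e e) := by
  simp only [submatrix_eq_mul_mul_transpose]
  exact inverseWishart_map_conj hδ hΨ _

end InverseWishart

section InverseWishartProcess

open Matrix

variable {T : Type*} {δ : ℕ} {Ψ : T × T → ℝ}

theorem measurable_gridMatrix (t : Finset T) : Measurable (gridMatrix t) :=
  measurable_matrix_iff.2 fun i j => measurable_pi_apply (i.1, j.1)

open Classical in
/-- The smallest finite set `t` such that the grid `t × t` contains a given finite set of pairs. -/
noncomputable def coordinateFinset (I : Finset (T × T)) : Finset T :=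
  I.image Prod.fst ∪ I.image Prod.snd

theorem coordinateFinset_subset_iff {I : Finset (T × T)} {t : Finset T} :
    coordinateFinset I ⊆ t ↔ I ⊆ t ×ˢ t := by
  classical
  rw [coordinateFinset, Finset.union_subset_iff, Finset.image_subset_iff, Finset.image_subset_iff,
    ← forall₂_and]
  simp only [Finset.subset_iff, Finset.mem_product]

/-- The entries, at a finite set `I` of pairs, of a matrix indexed by a grid containing `I`. -/
def gridEval {t : Finset T} {I : Finset (T × T)} (h : I ⊆ t ×ˢ t) (M : Matrix t t ℝ) : I → ℝ :=
  fun p => M ⟨p.1.1, (Finset.mem_product.1 (h p.2)).1⟩ ⟨p.1.2, (Finset.mem_product.1 (h p.2)).2⟩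

@[fun_prop]
theorem measurable_gridEval {t : Finset T} {I : Finset (T × T)} (h : I ⊆ t ×ˢ t) :
    Measurable (gridEval h) :=
  measurable_pi_lambda _ fun _ => measurable_matrix_iff.1 measurable_id _ _

open Classical in
/-- The finite-dimensional laws of an Inverse-Wishart process, obtained by evaluating the matrix
law on the smallest grid. -/
noncomputable def inverseWishartFamily (δ : ℕ) (Ψ : T × T → ℝ) (I : Finset (T × T)) :
    Measure (I → ℝ) :=
  (inverseWishart δ (gridMatrix (coordinateFinset I) Ψ)).map
    (gridEval (coordinateFinset_subset_iff.1 subset_rfl))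

instance isProbabilityMeasure_inverseWishartFamily (δ : ℕ) (Ψ : T × T → ℝ) (I : Finset (T × T)) :
    IsProbabilityMeasure (inverseWishartFamily δ Ψ I) := by
  classical
  exact Measure.isProbabilityMeasure_map (by fun_prop)

open Classical in
theorem inverseWishart_gridMatrix_map (hδ : 0 < δ) (hΨ : IsPosSemidefKernel Ψ) {s t : Finset T}
    (h : s ⊆ t) :
    (inverseWishart δ (gridMatrix t Ψ)).map
        (fun W => W.submatrix (Set.inclusion h) (Set.inclusion h)) =
      inverseWishart δ (gridMatrix s Ψ) :=
  inverseWishart_map_submatrix hδ (hΨ t) _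

open Classical in
theorem inverseWishartFamily_eq (hδ : 0 < δ) (hΨ : IsPosSemidefKernel Ψ) {t : Finset T}
    {I : Finset (T × T)} (h : I ⊆ t ×ˢ t) :
    inverseWishartFamily δ Ψ I = (inverseWishart δ (gridMatrix t Ψ)).map (gridEval h) := by
  rw [inverseWishartFamily,
    ← inverseWishart_gridMatrix_map hδ hΨ (coordinateFinset_subset_iff.2 h),
    Measure.map_map (by fun_prop) (by fun_prop)]
  rfl

theorem isProjectiveMeasureFamily_inverseWishartFamily (hδ : 0 < δ) (hΨ : IsPosSemidefKernel Ψ) :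
    IsProjectiveMeasureFamily (α := fun _ : T × T => ℝ) (inverseWishartFamily δ Ψ) := by
  intro I J hJI
  rw [inverseWishartFamily_eq hδ hΨ (hJI.trans (coordinateFinset_subset_iff.1 subset_rfl)),
    inverseWishartFamily]
  exact (Measure.map_map (Finset.measurable_restrict₂ (X := fun _ : T × T => ℝ) hJI)
    (measurable_gridEval _)).symm

theorem isProjectiveLimit_of_isInverseWishartProcess {μ : Measure (T × T → ℝ)}
    (hμ : IsInverseWishartProcess δ Ψ μ) :
    IsProjectiveLimit (α := fun _ => ℝ) μ (inverseWishartFamily δ Ψ) := by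
  classical
  intro I
  rw [inverseWishartFamily, ← hμ.2, Measure.map_map (measurable_gridEval _)
    (measurable_gridMatrix _)]
  rfl

theorem isInverseWishartProcess_of_isProjectiveLimit (hδ : 0 < δ) (hΨ : IsPosSemidefKernel Ψ)
    {μ : Measure (T × T → ℝ)}
    (hμ : IsProjectiveLimit (α := fun _ => ℝ) μ (inverseWishartFamily δ Ψ)) :
    IsInverseWishartProcess δ Ψ μ := by
  classical
  refine ⟨hμ.isProbabilityMeasure, fun t => ?_⟩
  let toMatrix (x : (t ×ˢ t : Finset (T × T)) → ℝ) : Matrix t t ℝ :=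
    Matrix.of fun i j => x ⟨(i, j), Finset.mk_mem_product i.2 j.2⟩
  have hmeas : Measurable toMatrix := measurable_matrix_iff.2 fun i j => measurable_pi_apply _
  have h := congrArg (Measure.map toMatrix) (hμ (t ×ˢ t))
  rw [inverseWishartFamily_eq hδ hΨ subset_rfl,
    Measure.map_map hmeas (Finset.measurable_restrict _),
    Measure.map_map hmeas (by fun_prop)] at h
  exact h.trans Measure.map_id

end InverseWishartProcess

theorem proposition1_general {T : Type*} (δ : ℕ) (hδ : 0 < δ) (Ψ : T × T → ℝ)
    (hΨ : IsPosSemidefKernel Ψ) :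
    ∃! μ : Measure (T × T → ℝ), IsInverseWishartProcess δ Ψ μ := by
  obtain ⟨μ, hμ⟩ :=
    exists_isProjectiveLimit (isProjectiveMeasureFamily_inverseWishartFamily hδ hΨ)
  exact ⟨μ, isInverseWishartProcess_of_isProjectiveLimit hδ hΨ hμ, fun ρ hρ =>
    (isProjectiveLimit_of_isInverseWishartProcess hρ).unique hμ⟩

theorem proposition1 (T : Set ℝ) (hT : IsCompact T) (δ : ℕ) (hδ : 4 < δ)
    (Ψ : T × T → ℝ) (hΨ : IsPosSemidefKernel Ψ) :
    ∃! μ : Measure (T × T → ℝ), IsInverseWishartProcess δ Ψ μ :=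
  proposition1_general δ (by lia) Ψ hΨ
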